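/- Let $A \in \mathbb{Z}^{m\times n}$. The dual graph $G_D(A)$ has the rows of $A$ as vertices, two distinct rows being adjacent if some column of $A$ is non-zero in both of them. A td-decomposition of a graph $G$ is a finite rooted forest $F$ (for instance a rooted tree) such that $G$ is a subgraph of the closure of $F$, the graph obtained from $F$ by making every vertex adjacent to all of its ancestors; $\mathrm{height}(F)$ is the maximum number of vertices on a root-leaf path of $F$. Let $\|A\|_\infty$ be the largest absolute value of an entry of $A$, and for a rational matrix $M$ let $\mathrm{fr}(M)$ be the largest denominator of an entry of $M$, the entries being written as fractions in lowest terms. Corollary. There is a computable function $g : \mathbb{N}\times\mathbb{N} \to \mathbb{N}$ such that for all $m,n$, every $A \in \mathbb{Z}^{m\times n}$, every td-decomposition $F$ of $G_D(A)$, and every collection of $m$ columns of $A$ that forms an invertible (over $\mathbb{Q}$) submatrix $A_B \in \mathbb{Z}^{m\times m}$, $$\mathrm{fr}(A_B^{-1}) \le g(\mathrm{height}(F), \|A\|_\infty).$$ -/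

import Mathlib

namespace MILP

/-- The primal graph of a matrix: its vertices are the columns, and two distinct columns are
adjacent when some row has nonzero entries in both. -/
def primalGraph {R C : Type*} (A : Matrix R C ℤ) : SimpleGraph C where
  Adj i j := i ≠ j ∧ ∃ k, A k i ≠ 0 ∧ A k j ≠ 0
  symm := ⟨fun _ _ ⟨hne, k, hi, hj⟩ => ⟨hne.symm, k, hj, hi⟩⟩
  loopless := ⟨fun _ h => h.1 rfl⟩

/-- The dual graph of a matrix: the primal graph of its transpose. -/
def dualGraph {R C : Type*} (A : Matrix R C ℤ) : SimpleGraph R :=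
  primalGraph A.transpose

/-- A rooted forest on the vertex set `W`, given by the parent of each vertex (`none` exactly at
the roots), such that iterating `parent` from any vertex ends at a root. A rooted tree is the case
of a single root. -/
structure RootedForest (W : Type*) where
  parent : W → Option W
  wf : WellFounded (fun u v : W => parent v = some u)

namespace RootedForest

variable {W : Type*} (F : RootedForest W)

/-- `u` is the parent of `v`. -/
def IsParent (u v : W) : Prop := F.parent v = some u

/-- `u` is a proper ancestor of `v`. -/
def IsAncestor (u v : W) : Prop := Relation.TransGen F.IsParent u v

theorem not_isAncestor_self (v : W) : ¬ F.IsAncestor v v := fun h =>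
  (show WellFounded (Relation.TransGen F.IsParent) from F.wf.transGen).irrefl.irrefl v h

/-- The closure of `F`: every vertex is adjacent to all of its ancestors (and descendants). -/
def closure : SimpleGraph W where
  Adj u v := F.IsAncestor u v ∨ F.IsAncestor v u
  symm := ⟨fun _ _ h => h.symm⟩
  loopless := ⟨fun v h => h.elim (F.not_isAncestor_self v) (F.not_isAncestor_self v)⟩

/-- The number of vertices on the path from the root above `v` down to `v`, both included. -/
noncomputable def depth (v : W) : ℕ := {u : W | u = v ∨ F.IsAncestor u v}.ncard

/-- The height of `F`: the maximum number of vertices on a root-leaf path. (The maximum of `depth`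
over all vertices is attained at a leaf, since a child is one deeper than its parent.) -/
noncomputable def height [Fintype W] : ℕ := Finset.univ.sup F.depth

/-- `F` is a treedepth decomposition of `G`: the graph `G` is a subgraph of the closure of `F`
(up to naming of vertices; `F` may have further vertices). -/
def IsTDDecomposition {V : Type*} (G : SimpleGraph V) : Prop := G.IsContained F.closure

end RootedForest

/-- The largest absolute value of an entry of an integer matrix. -/
def maxNorm {R C : Type*} [Fintype R] [Fintype C] (A : Matrix R C ℤ) : ℕ :=
  Finset.univ.sup fun i => Finset.univ.sup fun j => (A i j).natAbs

/-- The fractionality of a rational matrix: the largest denominator of an entry, entries being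
written in lowest terms. -/
def fractionality {R C : Type*} [Fintype R] [Fintype C] (M : Matrix R C ℚ) : ℕ :=
  Finset.univ.sup fun i => Finset.univ.sup fun j => (M i j).den

/-- The submatrix of `A` formed by the columns `b j`, over the rationals. -/
def columnSubmatrix {R C B : Type*} (A : Matrix R C ℤ) (b : B → C) : Matrix R B ℚ :=
  (A.submatrix id b).map (Int.cast : ℤ → ℚ)

end MILP

/-! Rows that are non-zero in a common column are comparable in the forest. Hence rows of depth at
least `d` whose root paths differ within depth `d` share no column, and these rows split into
column-disjoint blocks. Independence makes each block at least as wide as tall. The whole matrix is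
square, so if at most `k` rows have depth below `d`, at most `k` blocks are not square. A square
block is a self-contained invertible system with at most one row of depth `d`. Removing all square
blocks leaves an invertible system with at most `2k` rows of depth at most `d`. Recursing on both
(`clearsDenominators_of_layers`) squares the multiplier at each layer
(`ClearsDenominators.of_sdiff`). Once the layers are exhausted the systems have bounded size, and
Cramer's rule applies (`clearsDenominators_factorial`). The columns of the inverse are solutions
with integral right-hand sides. -/

namespace MILP

open Finset

/-! ### Linear algebra of square blocks. -/

section Blocks

variable {R C : Type*}

/-- The rows of `S`, restricted to the columns of `U`, are linearly independent over `ℚ`. -/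
def RowsIndependent (A : Matrix R C ℤ) (S : Finset R) (U : Finset C) : Prop :=
  ∀ y : R → ℚ, (∀ c ∈ U, ∑ r ∈ S, y r * A r c = 0) → ∀ r ∈ S, y r = 0

theorem RowsIndependent.card_le {A : Matrix R C ℤ} {S : Finset R} {U : Finset C}
    (hA : RowsIndependent A S U) : S.card ≤ U.card := by
  classical
  let M : Matrix S U ℚ := Matrix.of fun r c => (A r c : ℚ)
  have hinj : Function.Injective M.vecMulLinear := by
    rw [← LinearMap.ker_eq_bot, LinearMap.ker_eq_bot']
    intro y hy
    have := hA (fun r => if h : r ∈ S then y ⟨r, h⟩ else 0) (by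
      intro c hc
      rw [← Finset.sum_coe_sort S]
      simpa [M, Matrix.vecMul, dotProduct] using congrFun hy ⟨c, hc⟩)
    ext r
    simpa using this r r.2
  simpa using LinearMap.finrank_le_finrank_of_injective hinj

theorem rowsIndependent_iff_det_ne_zero [DecidableEq R] (A : Matrix R C ℤ) {S : Finset R}
    {U : Finset C} (e : S ≃ U) :
    RowsIndependent A S U ↔ (Matrix.of fun i j : S => (A i (e j) : ℚ)).det ≠ 0 := by
  rw [ne_eq, ← Matrix.exists_vecMul_eq_zero_iff]
  constructor
  · rintro hA ⟨y, hy0, hy⟩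
    apply hy0
    have := hA (fun r => if h : r ∈ S then y ⟨r, h⟩ else 0) (by
      intro c hc
      rw [← Finset.sum_coe_sort S]
      simpa [Matrix.vecMul, dotProduct] using congrFun hy (e.symm ⟨c, hc⟩))
    ext r
    simpa using this r r.2
  · intro hA y hy r hr
    by_contra hne
    refine hA ⟨fun r => y r, fun h => hne (congrFun h ⟨r, hr⟩), ?_⟩
    ext j
    have := hy (e j) (e j).2
    rw [← Finset.sum_coe_sort S] at this
    simpa [Matrix.vecMul, dotProduct] using this

theorem rowsIndependent_transpose_iff_det_ne_zero [DecidableEq R] (A : Matrix R C ℤ)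
    {S : Finset R} {U : Finset C} (e : S ≃ U) :
    RowsIndependent A.transpose U S ↔ (Matrix.of fun i j : S => (A i (e j) : ℚ)).det ≠ 0 := by
  classical
  rw [rowsIndependent_iff_det_ne_zero A.transpose e.symm, ← Matrix.det_transpose,
    ← Matrix.det_submatrix_equiv_self e]
  have : (Matrix.of fun i j : U => (A.transpose i (e.symm j) : ℚ)).transpose.submatrix e e
      = Matrix.of fun i j : S => (A i (e j) : ℚ) := by
    ext i j
    simp
  rw [this]

theorem rowsIndependent_transpose_iff (A : Matrix R C ℤ) {S : Finset R} {U : Finset C}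
    (h : S.card = U.card) : RowsIndependent A.transpose U S ↔ RowsIndependent A S U := by
  classical
  rw [rowsIndependent_transpose_iff_det_ne_zero A (Finset.equivOfCardEq h),
    rowsIndependent_iff_det_ne_zero A (Finset.equivOfCardEq h)]

/-- A relation among the rows `S'`, extended by zero, is a relation among the rows `S`: the columns
of `U` outside `U'` impose no condition. -/
theorem RowsIndependent.mono {A : Matrix R C ℤ} {S S' : Finset R} {U U' : Finset C}
    (hA : RowsIndependent A S U) (hS : S' ⊆ S)
    (h0 : ∀ r ∈ S', ∀ c ∈ U, c ∉ U' → A r c = 0) : RowsIndependent A S' U' := by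
  classical
  intro y hy r hr
  have := hA (fun r => if r ∈ S' then y r else 0) (by
    intro c hc
    have hsum : ∑ r ∈ S, (if r ∈ S' then y r else 0) * (A r c : ℚ)
        = ∑ r ∈ S', y r * (A r c : ℚ) := by
      rw [← Finset.sum_subset hS]
      · exact Finset.sum_congr rfl fun r hr => by simp [hr]
      · intro r _ hr
        simp [hr]
    rw [hsum]
    by_cases hcU : c ∈ U'
    · exact hy c hcU
    · exact Finset.sum_eq_zero fun r hr => by simp [h0 r hr c hc hcU]) r (hS hr)
  simpa [hr] using this

/-- `L` clears the denominators, in the columns `U`, of every rational vector `x` for which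
the system with rows `S` and columns `U` has an integral right-hand side. -/
def ClearsDenominators (A : Matrix R C ℤ) (S : Finset R) (U : Finset C) (L : ℕ) : Prop :=
  ∀ x : C → ℚ, (∀ r ∈ S, ∑ c ∈ U, (A r c : ℚ) * x c ∈ (Int.castRingHom ℚ).range) →
    ∀ c ∈ U, (L : ℚ) * x c ∈ (Int.castRingHom ℚ).range

/-- By Cramer's rule the determinant clears the denominators. The outer factorial is a common
multiple of all determinants within the bound, so it serves every block at once. -/
theorem clearsDenominators_factorial {A : Matrix R C ℤ} {S : Finset R} {U : Finset C}
    {a K : ℕ} (ha : ∀ r c, (A r c).natAbs ≤ a) (hK : S.card ≤ K) (hcard : S.card = U.card)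
    (hA : RowsIndependent A S U) :
    ClearsDenominators A S U (K.factorial * (a + 1) ^ K).factorial := by
  classical
  intro x hx c hc
  let e := Finset.equivOfCardEq hcard
  let M : Matrix S S ℤ := Matrix.of fun i j => A i (e j)
  have hM : (Matrix.of fun i j : S => (A i (e j) : ℚ)) = (Int.castRingHom ℚ).mapMatrix M := by
    ext i j
    simp [M]
  have hdet : M.det ≠ 0 := by
    have := (rowsIndependent_iff_det_ne_zero A e).1 hA
    rw [hM, ← RingHom.map_det] at this
    exact fun h => this (by simp [h])
  have hle : M.det.natAbs ≤ K.factorial * (a + 1) ^ K := by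
    have h1 : |M.det| ≤ (S.card.factorial : ℤ) * ((a : ℤ) + 1) ^ S.card := by
      have := Matrix.det_le (A := M) (abv := AbsoluteValue.abs) (x := ((a : ℤ) + 1)) (by
        intro i j
        have := ha i (e j)
        simp only [M, Matrix.of_apply, AbsoluteValue.abs_apply, Int.abs_eq_natAbs]
        omega)
      simpa [nsmul_eq_mul] using this
    have h2 : M.det.natAbs ≤ S.card.factorial * (a + 1) ^ S.card := by
      zify
      exact h1
    -- The base `a + 1`, rather than `a`, is positive, so the power is monotone in the exponent.
    exact h2.trans (Nat.mul_le_mul (Nat.factorial_le hK) (Nat.pow_le_pow_right (by omega) hK))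
  have hdvd : M.det ∣ ((K.factorial * (a + 1) ^ K).factorial : ℤ) :=
    Int.natAbs_dvd.1 (Int.natCast_dvd_natCast.2
      (Nat.dvd_factorial (Int.natAbs_pos.2 hdet) hle))
  have hkey : (M.det : ℚ) * x c ∈ (Int.castRingHom ℚ).range := by
    let N : Matrix S S ℚ := (Int.castRingHom ℚ).mapMatrix M
    let v : S → ℚ := fun j => x (e j)
    have hv : N.adjugate.mulVec (N.mulVec v) = N.det • v := by
      rw [Matrix.mulVec_mulVec, Matrix.adjugate_mul, Matrix.smul_mulVec, Matrix.one_mulVec]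
    have h3 := congrFun hv (e.symm ⟨c, hc⟩)
    have h4 : N.det = (M.det : ℚ) := by
      simp only [N, ← RingHom.map_det]
      simp
    simp only [Pi.smul_apply, smul_eq_mul, v, Equiv.apply_symm_apply, h4] at h3
    rw [← h3]
    refine Subring.sum_mem _ fun i _ => Subring.mul_mem _ ?_ ?_
    · simp only [N, ← RingHom.map_adjugate]
      exact ⟨M.adjugate _ i, rfl⟩
    · have := hx i i.2
      rw [← Finset.sum_coe_sort U, ← e.sum_comp] at this
      simpa [N, Matrix.mulVec, dotProduct, M] using this
  obtain ⟨q, hq⟩ := hdvd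
  have hq' : ((K.factorial * (a + 1) ^ K).factorial : ℚ) = M.det * q := by exact_mod_cast hq
  rw [hq', mul_comm (M.det : ℚ), mul_assoc]
  exact Subring.mul_mem _ ⟨q, rfl⟩ hkey

/-- Block triangular elimination: clear the columns `V` first, then the remaining ones by means of
the rows outside `P`. -/
theorem ClearsDenominators.of_sdiff [DecidableEq R] [DecidableEq C] {A : Matrix R C ℤ}
    {S P : Finset R} {U V : Finset C} {L L' : ℕ} (hV : V ⊆ U)
    (h1 : ClearsDenominators A (S \ P) (U \ V) L)
    (h2 : ∀ x : C → ℚ, (∀ r ∈ S, ∑ c ∈ U, (A r c : ℚ) * x c ∈ (Int.castRingHom ℚ).range) →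
      ∀ c ∈ V, (L' : ℚ) * x c ∈ (Int.castRingHom ℚ).range) :
    ClearsDenominators A S U (L * L') := by
  intro x hx c hc
  by_cases hcV : c ∈ V
  · rw [Nat.cast_mul, mul_assoc]
    exact Subring.mul_mem _ ⟨L, by simp⟩ (h2 x hx c hcV)
  · rw [Nat.cast_mul, mul_assoc]
    -- After scaling by `L'`, the columns of `V` contribute integers and can be moved to the
    -- right-hand side.
    refine h1 (fun c => L' * x c) (fun r hr => ?_) c (Finset.mem_sdiff.2 ⟨hc, hcV⟩)
    have h3 : ∑ c ∈ U \ V, (A r c : ℚ) * (L' * x c)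
        = L' * ∑ c ∈ U, (A r c : ℚ) * x c - ∑ c ∈ V, (A r c : ℚ) * (L' * x c) := by
      rw [eq_sub_iff_add_eq, Finset.sum_sdiff hV, Finset.mul_sum]
      exact Finset.sum_congr rfl fun c _ => by ring
    rw [h3]
    exact Subring.sub_mem _ (Subring.mul_mem _ ⟨L', by simp⟩ (hx r (Finset.mem_sdiff.1 hr).1))
      (Subring.sum_mem _ fun c hc => Subring.mul_mem _ ⟨A r c, rfl⟩ (h2 x hx c hc))

/-- Here `j` counts the layers left. Passing to the next layer may double `k`, so `k * 2 ^ j` is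
kept below a fixed `K`; `hj` is what allows a restart with `k = 1` inside a square block. -/
theorem clearsDenominators_of_layers {X : Type*} {A : Matrix R C ℤ} {a K : ℕ}
    (ha : ∀ r c, (A r c).natAbs ≤ a) (dep : R → ℕ) (anc : ℕ → R → X)
    (hcol : ∀ r r' c d, A r c ≠ 0 → A r' c ≠ 0 → d ≤ dep r → d ≤ dep r' → anc d r = anc d r')
    (hinj : ∀ r r', dep r = dep r' → anc (dep r) r = anc (dep r) r' → r = r')
    (j : ℕ) (hj : 2 ^ j ≤ K) (d k : ℕ) (hk : k * 2 ^ j ≤ K) (S : Finset R) (U : Finset C)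
    (hcard : S.card = U.card) (hA : RowsIndependent A S U)
    (hT : (S.filter fun r => dep r < d).card ≤ k) (hS : ∀ r ∈ S, dep r < d + j) :
    ClearsDenominators A S U ((K.factorial * (a + 1) ^ K).factorial ^ 2 ^ j) := by
  classical
  induction j generalizing d k S U with
  | zero =>
    rw [pow_zero, pow_one]
    refine clearsDenominators_factorial ha ?_ hcard hA
    rw [Finset.filter_true_of_mem (by simpa using hS)] at hT
    omega
  | succ j ih =>
    have hj' : 2 ^ j ≤ K := le_trans (Nat.pow_le_pow_right (by norm_num) (Nat.le_succ j)) hj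
    let T := S.filter fun r => dep r < d
    let Sw : X → Finset R := fun w => S.filter fun r => d ≤ dep r ∧ anc d r = w
    let Uw : X → Finset C := fun w => U.filter fun c => ∃ r ∈ Sw w, A r c ≠ 0
    let keys : Finset X := S.image (anc d)
    have hSdisj : ∀ s : Finset X, (s : Set X).PairwiseDisjoint Sw := by
      intro s w _ w' _ hne
      refine Finset.disjoint_left.2 fun r hr hr' => hne ?_
      exact (Finset.mem_filter.1 hr).2.2.symm.trans (Finset.mem_filter.1 hr').2.2
    have hUdisj : ∀ s : Finset X, (s : Set X).PairwiseDisjoint Uw := by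
      intro s w _ w' _ hne
      refine Finset.disjoint_left.2 fun c hc hc' => hne ?_
      obtain ⟨r, hr, hrc⟩ := (Finset.mem_filter.1 hc).2
      obtain ⟨r', hr', hrc'⟩ := (Finset.mem_filter.1 hc').2
      have h1 := (Finset.mem_filter.1 hr).2
      have h2 := (Finset.mem_filter.1 hr').2
      rw [← h1.2, ← h2.2]
      exact hcol r r' c d hrc hrc' h1.1 h2.1
    have hzero : ∀ w, ∀ r ∈ Sw w, ∀ c ∈ U, c ∉ Uw w → A r c = 0 := by
      intro w r hr c hc hcw
      by_contra hne
      exact hcw (Finset.mem_filter.2 ⟨hc, r, hr, hne⟩)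
    have hAw : ∀ w, RowsIndependent A (Sw w) (Uw w) := fun w =>
      hA.mono (Finset.filter_subset _ _) (hzero w)
    let good := keys.filter fun w => (Sw w).card = (Uw w).card
    let bad := keys.filter fun w => ¬ (Sw w).card = (Uw w).card
    have hbad : bad.card ≤ k := by
      have h1 : ∑ w ∈ keys, (Sw w).card + T.card = S.card := by
        rw [← Finset.card_biUnion (fun w hw w' hw' h => hSdisj keys hw hw' h),
          ← Finset.card_union_of_disjoint]
        · congr 1
          ext r
          simp only [Finset.mem_union, Finset.mem_biUnion, Finset.mem_image, Finset.mem_filter,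
            keys, Sw, T]
          constructor
          · rintro (⟨_, _, h, _⟩ | ⟨h, _⟩) <;> exact h
          · intro h
            rcases lt_or_ge (dep r) d with hd | hd
            · exact Or.inr ⟨h, hd⟩
            · exact Or.inl ⟨anc d r, ⟨r, h, rfl⟩, h, hd, rfl⟩
        · refine Finset.disjoint_left.2 fun r hr hr' => ?_
          obtain ⟨w, _, hw⟩ := Finset.mem_biUnion.1 hr
          have h1 := (Finset.mem_filter.1 hw).2.1
          have h2 := (Finset.mem_filter.1 hr').2
          omega
      have h2 : ∑ w ∈ keys, (Uw w).card ≤ U.card := by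
        rw [← Finset.card_biUnion (fun w hw w' hw' h => hUdisj keys hw hw' h)]
        exact Finset.card_le_card (Finset.biUnion_subset.2 fun w _ => Finset.filter_subset _ _)
      -- Each non-square block has at least one surplus column.
      have h3 : ∑ w ∈ keys, (Sw w).card + bad.card ≤ ∑ w ∈ keys, (Uw w).card := by
        rw [Finset.card_filter, ← Finset.sum_add_distrib]
        refine Finset.sum_le_sum fun w _ => ?_
        have := (hAw w).card_le
        split_ifs <;> omega
      have h4 : T.card ≤ k := hT
      omega
    let P := good.biUnion Sw
    let V := good.biUnion Uw
    have hPS : P ⊆ S := Finset.biUnion_subset.2 fun w _ => Finset.filter_subset _ _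
    have hVU : V ⊆ U := Finset.biUnion_subset.2 fun w _ => Finset.filter_subset _ _
    have hPV : P.card = V.card := by
      rw [Finset.card_biUnion (fun w hw w' hw' h => hSdisj good hw hw' h),
        Finset.card_biUnion (fun w hw w' hw' h => hUdisj good hw hw' h)]
      exact Finset.sum_congr rfl fun w hw => (Finset.mem_filter.1 hw).2
    have hcard' : (S \ P).card = (U \ V).card := by
      rw [Finset.card_sdiff_of_subset hPS, Finset.card_sdiff_of_subset hVU]
      omega
    rw [pow_succ 2 j, pow_mul, pow_two]
    refine ClearsDenominators.of_sdiff (P := P) hVU ?_ ?_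
    · refine ih hj' (d + 1) (k * 2) (by rw [mul_assoc, ← pow_succ']; exact hk) _ _ hcard' ?_ ?_ ?_
      · rw [← rowsIndependent_transpose_iff A hcard']
        refine ((rowsIndependent_transpose_iff A hcard).2 hA).mono Finset.sdiff_subset ?_
        intro c hc r hr hrP
        have hrP : r ∈ P := by
          by_contra h
          exact hrP (Finset.mem_sdiff.2 ⟨hr, h⟩)
        obtain ⟨w, hw, hrw⟩ := Finset.mem_biUnion.1 hrP
        exact hzero w r hrw c (Finset.mem_sdiff.1 hc).1 fun h =>
          (Finset.mem_sdiff.1 hc).2 (Finset.mem_biUnion.2 ⟨w, hw, h⟩)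
      · have hsub : (S \ P).filter (fun r => dep r < d + 1) ⊆
            T ∪ (S \ P).filter (fun r => dep r = d) := by
          intro r hr
          simp only [T, Finset.mem_union, Finset.mem_filter, Finset.mem_sdiff] at hr ⊢
          rcases lt_or_ge (dep r) d with hd | hd
          · exact Or.inl ⟨hr.1.1, hd⟩
          · exact Or.inr ⟨hr.1, by omega⟩
        -- Every remaining row of depth `d` lies in a non-square block, and no block has two such
        -- rows.
        have hle : ((S \ P).filter (fun r => dep r = d)).card ≤ bad.card := by
          refine Finset.card_le_card_of_injOn (anc d) ?_ ?_
          · intro r hr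
            obtain ⟨hr, hd⟩ := Finset.mem_filter.1 hr
            obtain ⟨hr, hrP⟩ := Finset.mem_sdiff.1 hr
            refine Finset.mem_filter.2 ⟨Finset.mem_image_of_mem _ hr, fun h => hrP ?_⟩
            exact Finset.mem_biUnion.2 ⟨anc d r,
              Finset.mem_filter.2 ⟨Finset.mem_image_of_mem _ hr, h⟩,
              Finset.mem_filter.2 ⟨hr, hd.ge, rfl⟩⟩
          · intro r hr r' hr' h
            have h1 := (Finset.mem_filter.1 hr).2
            have h2 := (Finset.mem_filter.1 hr').2
            exact hinj r r' (h1.trans h2.symm) (by rw [h1]; exact h)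
        have h1 := Finset.card_le_card hsub
        have h2 := Finset.card_union_le T ((S \ P).filter (fun r => dep r = d))
        have h3 : T.card ≤ k := hT
        omega
      · intro r hr
        have := hS r (Finset.mem_sdiff.1 hr).1
        omega
    · intro x hx c hc
      obtain ⟨w, hw, hcw⟩ := Finset.mem_biUnion.1 hc
      refine ih hj' (d + 1) 1 (by simpa using hj') (Sw w) (Uw w) (Finset.mem_filter.1 hw).2
        (hAw w) ?_ ?_ x ?_ c hcw
      · refine Finset.card_le_one.2 fun r hr r' hr' => ?_
        simp only [Sw, Finset.mem_filter] at hr hr'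
        have h1 : dep r = d := by omega
        have h2 : dep r' = d := by omega
        exact hinj r r' (h1.trans h2.symm) (by rw [h1, hr.1.2.2, hr'.1.2.2])
      · intro r hr
        have := hS r (Finset.mem_filter.1 hr).1
        omega
      · intro r hr
        rw [Finset.sum_subset (Finset.filter_subset _ U)]
        · exact hx r (Finset.mem_filter.1 hr).1
        · intro c hc hcw
          simp [hzero w r hr c hc hcw]

end Blocks

/-! ### Ancestor paths in a rooted forest. -/

namespace RootedForest

variable {W : Type*} (F : RootedForest W)

/-- Parents are unique, so the ancestors of a vertex form a chain. -/
theorem IsAncestor.trichotomy {F : RootedForest W} {u v w : W} (hu : F.IsAncestor u w)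
    (hv : F.IsAncestor v w) : u = v ∨ F.IsAncestor u v ∨ F.IsAncestor v u := by
  induction hu using Relation.TransGen.head_induction_on with
  | @single u h =>
    rcases Relation.TransGen.tail'_iff.1 hv with ⟨b, hb, hbw⟩
    have hub : u = b := Option.some.inj (h.symm.trans hbw)
    subst hub
    rcases Relation.reflTransGen_iff_eq_or_transGen.1 hb with h | h
    · exact Or.inl h
    · exact Or.inr (Or.inr h)
  | @head u p h _ ih =>
    rcases ih with rfl | h' | h'
    · exact Or.inr (Or.inl (.single h))
    · exact Or.inr (Or.inl (.head h h'))
    · rcases Relation.TransGen.tail'_iff.1 h' with ⟨b, hb, hbp⟩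
      have hub : u = b := Option.some.inj (h.symm.trans hbp)
      subst hub
      rcases Relation.reflTransGen_iff_eq_or_transGen.1 hb with h | h
      · exact Or.inl h
      · exact Or.inr (Or.inr h)

theorem depth_pos [Finite W] (v : W) : 0 < F.depth v :=
  (Set.ncard_pos (Set.toFinite _)).2 ⟨v, Or.inl rfl⟩

theorem depth_lt_of_isAncestor [Finite W] {u v : W} (h : F.IsAncestor u v) :
    F.depth u < F.depth v := by
  refine Set.ncard_lt_ncard ⟨?_, fun hsub => ?_⟩ (Set.toFinite _)
  · rintro w (rfl | hw)
    · exact Or.inr h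
    · exact Or.inr (hw.trans h)
  · rcases hsub (Or.inl rfl : v = v ∨ F.IsAncestor v v) with rfl | h'
    · exact F.not_isAncestor_self _ h
    · exact F.not_isAncestor_self _ (h.trans h')

theorem depth_le_height [Fintype W] (v : W) : F.depth v ≤ F.height :=
  Finset.le_sup (Finset.mem_univ v)

/-- The vertices of depth at most `d` on the path from the root above `v` down to `v`. -/
def initialPath (d : ℕ) (v : W) : Set W := {u | (u = v ∨ F.IsAncestor u v) ∧ F.depth u ≤ d}

theorem initialPath_eq_of_isAncestor [Finite W] {u v : W} {d : ℕ} (h : F.IsAncestor u v)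
    (hd : d ≤ F.depth u) : F.initialPath d u = F.initialPath d v := by
  ext w
  constructor
  · rintro ⟨rfl | hw, hwd⟩
    · exact ⟨Or.inr h, hwd⟩
    · exact ⟨Or.inr (hw.trans h), hwd⟩
  · rintro ⟨hw, hwd⟩
    refine ⟨?_, hwd⟩
    have hnot : ¬ F.IsAncestor u w := fun h' => by
      have := F.depth_lt_of_isAncestor h'
      omega
    rcases hw with rfl | hw
    · exact absurd h hnot
    · rcases hw.trichotomy h with h' | h' | h'
      · exact Or.inl h'
      · exact Or.inr h'
      · exact absurd h' hnot

theorem eq_of_initialPath_depth_eq {u v : W} (hd : F.depth u = F.depth v)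
    (h : F.initialPath (F.depth u) u = F.initialPath (F.depth u) v) : u = v := by
  have h1 : u ∈ F.initialPath (F.depth u) v := h ▸ ⟨Or.inl rfl, le_rfl⟩
  have h2 : v ∈ F.initialPath (F.depth u) u := h ▸ ⟨Or.inl rfl, hd.ge⟩
  rcases h1.1 with h1 | h1
  · exact h1
  · rcases h2.1 with h2 | h2
    · exact h2.symm
    · exact absurd (h1.trans h2) (F.not_isAncestor_self u)

end RootedForest

theorem natAbs_le_maxNorm {R C : Type*} [Fintype R] [Fintype C] (A : Matrix R C ℤ) (r : R)
    (c : C) : (A r c).natAbs ≤ maxNorm A :=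
  (Finset.le_sup (f := fun c => (A r c).natAbs) (Finset.mem_univ c)).trans
    (Finset.le_sup (f := fun r => Finset.univ.sup fun c => (A r c).natAbs) (Finset.mem_univ r))

/-- The bound on the fractionality in terms of the height `h` and the largest entry `a`. -/
def fractionalityBound (h a : ℕ) : ℕ :=
  ((2 ^ h).factorial * (a + 1) ^ 2 ^ h).factorial ^ 2 ^ h

/-! ### Computability of the bound. -/

theorem primrec_factorial : Primrec Nat.factorial :=
  (Primrec.nat_rec₁ 1 (Primrec.nat_mul.comp (Primrec.succ.comp Primrec.fst) Primrec.snd).to₂).of_eq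
    fun n => by induction n with
      | zero => rfl
      | succ n ih => simp [Nat.factorial_succ, ← ih]

theorem primrec_pow : Primrec₂ fun a b : ℕ => a ^ b :=
  (Primrec.nat_rec (f := fun _ : ℕ => 1) (g := fun a p => p.2 * a) (Primrec.const 1)
    (Primrec.nat_mul.comp (Primrec.snd.comp Primrec.snd) Primrec.fst).to₂).of_eq
    fun a b => by induction b with
      | zero => rfl
      | succ b ih => simp [pow_succ, ← ih]

theorem computable_fractionalityBound : Computable₂ fractionalityBound := by
  have h2 : Primrec fun p : ℕ × ℕ => 2 ^ p.1 := primrec_pow.comp (Primrec.const 2) Primrec.fst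
  exact (primrec_pow.comp (primrec_factorial.comp (Primrec.nat_mul.comp (primrec_factorial.comp h2)
    (primrec_pow.comp (Primrec.succ.comp Primrec.snd) h2))) h2).to_comp

end MILP

theorem mainTheorem3 :
    ∃ g : ℕ → ℕ → ℕ, Computable₂ g ∧
      ∀ (m n : ℕ) (A : Matrix (Fin m) (Fin n) ℤ)
        (W : Type) [Fintype W] (F : MILP.RootedForest W),
        F.IsTDDecomposition (MILP.dualGraph A) →
        ∀ B : Fin m ↪ Fin n,
          IsUnit (MILP.columnSubmatrix A B) →
          MILP.fractionality (MILP.columnSubmatrix A B)⁻¹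
            ≤ g F.height (MILP.maxNorm A) := by
  refine ⟨MILP.fractionalityBound, MILP.computable_fractionalityBound, ?_⟩
  rintro m n A W _ F ⟨f⟩ B hB
  have hdet := (Matrix.isUnit_iff_isUnit_det _).1 hB
  have hind : MILP.RowsIndependent (A.submatrix id B) Finset.univ Finset.univ := by
    intro y hy r _
    have h0 : Matrix.vecMul y (MILP.columnSubmatrix A B) = 0 := by
      ext c
      simpa [MILP.columnSubmatrix, Matrix.vecMul, dotProduct] using hy c (Finset.mem_univ c)
    exact congrFun (Matrix.eq_zero_of_vecMul_eq_zero hdet.ne_zero h0) r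
  have hclear := MILP.clearsDenominators_of_layers (A := A.submatrix id B)
    (a := MILP.maxNorm A) (K := 2 ^ F.height) (fun r c => MILP.natAbs_le_maxNorm A r (B c))
    (fun r => F.depth (f r)) (fun d r => F.initialPath d (f r))
    (by
      intro r r' c d hr hr' hd hd'
      by_cases hne : r = r'
      · rw [hne]
      · have hadj : (MILP.dualGraph A).Adj r r' := ⟨hne, B c, hr, hr'⟩
        rcases f.toHom.map_adj hadj with h | h
        · exact F.initialPath_eq_of_isAncestor h hd
        · exact (F.initialPath_eq_of_isAncestor h hd').symm)
    (fun r r' hd h => f.injective (F.eq_of_initialPath_depth_eq hd h))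
    -- Depths start at 1, so no row lies above the first layer and `k = 0`.
    F.height le_rfl 1 0 (by simp) Finset.univ Finset.univ rfl hind
    (by
      rw [Finset.filter_false_of_mem fun r _ => by
        have := F.depth_pos (f r)
        omega]
      rfl)
    (fun r _ => by
      have := F.depth_le_height (f r)
      omega)
  refine Finset.sup_le fun i _ => Finset.sup_le fun j _ => ?_
  obtain ⟨z, hz⟩ := hclear (fun c => (MILP.columnSubmatrix A B)⁻¹ c j) (by
    intro r _
    have h1 := congrFun (congrFun (Matrix.mul_nonsing_inv _ hdet) r) j
    simp only [Matrix.mul_apply, Matrix.one_apply] at h1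
    refine ⟨if r = j then 1 else 0, ?_⟩
    rw [show ∑ c, ((A.submatrix id B r c : ℤ) : ℚ) * (MILP.columnSubmatrix A B)⁻¹ c j = _ from h1]
    split_ifs <;> simp) i (Finset.mem_univ i)
  set q := (MILP.columnSubmatrix A B)⁻¹ i j
  have hq : MILP.fractionalityBound F.height (MILP.maxNorm A) * q = z := hz.symm
  have hpos : 0 < MILP.fractionalityBound F.height (MILP.maxNorm A) :=
    pow_pos (Nat.factorial_pos _) _
  -- The entry is an integer over the bound, so its reduced denominator divides the bound.
  refine Nat.le_of_dvd hpos (Int.natCast_dvd_natCast.1 ?_)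
  have hdiv : q = Rat.divInt z (MILP.fractionalityBound F.height (MILP.maxNorm A)) := by
    rw [Rat.divInt_eq_div, ← hq]
    have : (MILP.fractionalityBound F.height (MILP.maxNorm A) : ℚ) ≠ 0 := by
      exact_mod_cast hpos.ne'
    push_cast
    field_simp
  rw [hdiv]
  exact Rat.den_dvd _ _
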